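/- **Theorem.** Call a set of points in the Euclidean plane in general position if no three distinct points of it are collinear and no four distinct points of it are concyclic. A point stabs a disk if it lies in the interior of the disk. For a finite point set $P$ in general position, let $st_{\mathcal D}(P)$ be the minimum of $|W|$ over all finite point sets $W$ such that $P\cup W$ is in general position and every disk whose boundary contains at least two points of $P$ is stabbed by some point of $W$. Let $st_{\mathcal D}(n)=\max_{|P|=n} st_{\mathcal D}(P)$, the maximum being over all sets $P$ of $n$ points in general position. Then for every integer $n\ge 2$, $$n\le st_{\mathcal D}(n)\le 2n-2 .$$ Moreover $st_{\mathcal D}(n)=\max_{|P|=n}\min\{|W| : DG^-(P,W)\text{ has no edges}\}$, with the same general position requirements on $P$ and $P\cup W$. Here $DG^-(P,W)$ is the witness Delaunay graph: its vertex set is $P$, and two distinct points $x,y\in P$ are adjacent if and only if there is an open disk containing no point of $W$ whose bounding circle passes through $x$ and $y$. -/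

import Mathlib

/-- The Euclidean plane. -/
abbrev Plane : Type := EuclideanSpace ℝ (Fin 2)

/-- General position: no three distinct points of `S` are collinear and no four distinct points
of `S` lie on a common circle. -/
def InGeneralPosition (S : Set Plane) : Prop :=
  (∀ a ∈ S, ∀ b ∈ S, ∀ c ∈ S, a ≠ b → a ≠ c → b ≠ c →
    ¬ Collinear ℝ ({a, b, c} : Set Plane)) ∧
  (∀ a ∈ S, ∀ b ∈ S, ∀ c ∈ S, ∀ d ∈ S, a ≠ b → a ≠ c → a ≠ d → b ≠ c → b ≠ d → c ≠ d →
    ¬ EuclideanGeometry.Cospherical ({a, b, c, d} : Set Plane))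

/-- The family of all disks (of positive radius) whose boundary circle contains at least two
distinct points of `P`. -/
def diskFamily (P : Set Plane) : Set (Set Plane) :=
  {D | ∃ (c : Plane) (r : ℝ), 0 < r ∧ D = Metric.closedBall c r ∧
    ∃ p ∈ P, ∃ q ∈ P, p ≠ q ∧ p ∈ Metric.sphere c r ∧ q ∈ Metric.sphere c r}

/-- The point `w` stabs the object `Q` if it lies in the interior of `Q`. -/
def Stabs (w : Plane) (Q : Set Plane) : Prop := w ∈ interior Q

/-- Every object of the family `F` is stabbed by some point of `W`. -/
def IsStabbingSet (W : Set Plane) (F : Set (Set Plane)) : Prop :=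
  ∀ Q ∈ F, ∃ w ∈ W, Stabs w Q

/-- The witness Delaunay graph of `P` with respect to `W`: two distinct points of `P` are adjacent
iff some open disk whose bounding circle passes through both contains no point of `W`. -/
def witnessDelaunayGraph (P W : Set Plane) : SimpleGraph P where
  Adj x y := x ≠ y ∧ ∃ (c : Plane) (r : ℝ), 0 < r ∧
    (x : Plane) ∈ Metric.sphere c r ∧ (y : Plane) ∈ Metric.sphere c r ∧
    ∀ w ∈ W, w ∉ Metric.ball c r
  symm := ⟨fun _ _ h => by
    obtain ⟨hne, c, r, hr, hx, hy, hw⟩ := h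
    exact ⟨hne.symm, c, r, hr, hy, hx, hw⟩⟩
  loopless := ⟨fun _ h => h.1 rfl⟩

/-- The least size of a finite point set `W`, with `P ∪ W` in general position, that stabs all
disks whose boundary contains two points of `P` (it is `⊤` if there is no such `W`). -/
noncomputable def diskStabbingNumber (P : Finset Plane) : ℕ∞ :=
  ⨅ (W : Finset Plane) (_ : InGeneralPosition ((P : Set Plane) ∪ W))
    (_ : IsStabbingSet W (diskFamily P)), (W.card : ℕ∞)

/-- The least size of a finite point set `W`, with `P ∪ W` in general position, for which the
witness Delaunay graph of `P` with respect to `W` has no edges (`⊤` if there is no such `W`). -/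
noncomputable def edgelessWitnessNumber (P : Finset Plane) : ℕ∞ :=
  ⨅ (W : Finset Plane) (_ : InGeneralPosition ((P : Set Plane) ∪ W))
    (_ : witnessDelaunayGraph (P : Set Plane) W = ⊥), (W.card : ℕ∞)

/-- The worst case of `diskStabbingNumber` over all `n`-point sets in general position. -/
noncomputable def maxDiskStabbingNumber (n : ℕ) : ℕ∞ :=
  ⨆ (P : Finset Plane) (_ : P.card = n) (_ : InGeneralPosition (P : Set Plane)),
    diskStabbingNumber P

/-- The worst case of `edgelessWitnessNumber` over all `n`-point sets in general position. -/
noncomputable def maxEdgelessWitnessNumber (n : ℕ) : ℕ∞ :=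
  ⨆ (P : Finset Plane) (_ : P.card = n) (_ : InGeneralPosition (P : Set Plane)),
    edgelessWitnessNumber P

/-! Upper bound. Fix a direction `u` neither parallel nor perpendicular to any line through two
points of `P`. Give each point one witness close to it in direction `u` and one in direction `-u`;
the last point in each direction needs none, which leaves at most `2n - 2`. If `p` and `q` lie on
the boundary of a disk and `q` is ahead of `p`, then the forward witness of `p` and the backward
witness of `q` lie inside the circle with diameter `pq`, on opposite sides of the line `pq`. Every
disk through `p` and `q` contains one of the two open halves of that diametral disk, hence one of
the witnesses (`mem_ball_or_mem_ball`). The conditions on witnesses are open and the positions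
violating general position form a null set, so generic witnesses exist
(`InGeneralPosition.exists_image`).

Lower bound for `n ≥ 3`. Arrange `n` congruent disks in a ring, consecutive ones tangent, and let
`P` be a generic perturbation of the contact points. From any contact point, a chain of `n` disks
can be run once around the ring, each through two consecutive points of `P` and tangent to its
predecessor. Only the last and the first disk can overlap, and only near the starting point
(`CoinRing.eventually_tangentChain`). Fewer than `n` stabbing points would force one of them into
such an overlap. This holds for each of the `n` starting points, whose neighbourhoods are disjoint,
so there would be `n` points after all.

For `n = 2`, a single witness off the line `pq` lies on some circle through `p` and `q`, and does
not stab that disk.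

The two extremal numbers agree because an unstabbed disk is exactly what makes an edge. -/

open MeasureTheory

/-! ### General position and generic choice of points -/

theorem InGeneralPosition.mono {S T : Set Plane} (hT : InGeneralPosition T) (h : S ⊆ T) :
    InGeneralPosition S :=
  ⟨fun a ha b hb c hc => hT.1 a (h ha) b (h hb) c (h hc),
    fun a ha b hb c hc d hd => hT.2 a (h ha) b (h hb) c (h hc) d (h hd)⟩

theorem inGeneralPosition_empty : InGeneralPosition ∅ :=
  ⟨fun _ ha => ha.elim, fun _ ha => ha.elim⟩

theorem InGeneralPosition.insert_point {S : Set Plane} (hS : InGeneralPosition S) {w : Plane}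
    (h3 : ∀ a ∈ S, ∀ b ∈ S, a ≠ b → ¬ Collinear ℝ ({w, a, b} : Set Plane))
    (h4 : ∀ a ∈ S, ∀ b ∈ S, ∀ c ∈ S, a ≠ b → a ≠ c → b ≠ c →
      ¬ EuclideanGeometry.Cospherical ({w, a, b, c} : Set Plane)) :
    InGeneralPosition (insert w S) := by
  constructor
  · rintro a (rfl | ha) b (rfl | hb) c (rfl | hc) hab hac hbc
    all_goals try contradiction
    · exact h3 b hb c hc hbc
    · rw [Set.insert_comm]; exact h3 a ha c hc hac
    · rw [Set.pair_comm, Set.insert_comm]; exact h3 a ha b hb hab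
    · exact hS.1 a ha b hb c hc hab hac hbc
  · rintro a (rfl | ha) b (rfl | hb) c (rfl | hc) d (rfl | hd) hab hac had hbc hbd hcd
    all_goals try contradiction
    · exact h4 b hb c hc d hd hbc hbd hcd
    · rw [Set.insert_comm]; exact h4 a ha c hc d hd hac had hcd
    · rw [Set.insert_comm b, Set.insert_comm]; exact h4 a ha b hb d hd hab had hbd
    · rw [Set.pair_comm, Set.insert_comm b, Set.insert_comm]
      exact h4 a ha b hb c hc hab hac hbc
    · exact hS.2 a ha b hb c hc d hd hab hac had hbc hbd hcd

theorem volume_collinear_eq_zero (a b : Plane) (hab : a ≠ b) :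
    volume {w : Plane | Collinear ℝ ({w, a, b} : Set Plane)} = 0 := by
  have hne : line[ℝ, a, b] ≠ ⊤ := by
    intro h
    have h1 := collinear_iff_finrank_le_one.1 (collinear_pair ℝ a b)
    rw [← direction_affineSpan, h, AffineSubspace.direction_top, finrank_top,
      finrank_euclideanSpace_fin] at h1
    omega
  refine measure_mono_null ?_ (Measure.addHaar_affineSubspace volume _ hne)
  intro w hw
  exact hw.mem_affineSpan_of_mem_of_ne (p₁ := a) (p₂ := b) (p₃ := w) (by simp) (by simp)
    (by simp) hab

/-- In the plane, the only circle through a nondegenerate triangle is its circumcircle, which is a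
null set. -/
theorem volume_cospherical_eq_zero (a b c : Plane)
    (h : ¬ Collinear ℝ ({a, b, c} : Set Plane)) :
    volume {w : Plane | EuclideanGeometry.Cospherical ({w, a, b, c} : Set Plane)} = 0 := by
  have hai : AffineIndependent ℝ ![a, b, c] := affineIndependent_iff_not_collinear_set.2 h
  let t : Affine.Simplex ℝ Plane 2 := ⟨![a, b, c], hai⟩
  have htop : affineSpan ℝ (Set.range t.points) = ⊤ := by
    rw [t.independent.affineSpan_eq_top_iff_card_eq_finrank_add_one]
    simp
  refine measure_mono_null ?_
    (Measure.addHaar_sphere (volume : Measure Plane) t.circumcenter t.circumradius)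
  rintro w ⟨z, r, hz⟩
  have hzt : ∀ i, dist (t.points i) z = r := by
    intro i
    apply hz
    fin_cases i <;> simp [t]
  have h1 := t.eq_circumcenter_of_dist_eq (by rw [htop]; trivial) hzt
  have h2 := t.eq_circumradius_of_dist_eq (by rw [htop]; trivial) hzt
  rw [Metric.mem_sphere, ← h1, ← h2]
  exact hz w (by simp)

/-- The forbidden positions are finitely many points, lines and circles; their union is null and
cannot cover a nonempty open set. -/
theorem InGeneralPosition.exists_insert {S : Set Plane} (hS : InGeneralPosition S)
    (hfin : S.Finite) {U : Set Plane} (hU : IsOpen U) (hne : U.Nonempty) :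
    ∃ w ∈ U, w ∉ S ∧ InGeneralPosition (insert w S) := by
  let B : Set Plane := S ∪
    ((⋃ a ∈ S, ⋃ b ∈ S, ⋃ (_ : a ≠ b), {w | Collinear ℝ ({w, a, b} : Set Plane)}) ∪
    (⋃ a ∈ S, ⋃ b ∈ S, ⋃ c ∈ S, ⋃ (_ : ¬ Collinear ℝ ({a, b, c} : Set Plane)),
      {w | EuclideanGeometry.Cospherical ({w, a, b, c} : Set Plane)}))
  have hB : volume B = 0 := by
    refine measure_union_null (hfin.measure_zero _) (measure_union_null ?_ ?_)
    · refine (measure_biUnion_null_iff hfin.countable).2 fun a _ =>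
        (measure_biUnion_null_iff hfin.countable).2 fun b _ => measure_iUnion_null fun hab =>
          volume_collinear_eq_zero a b hab
    · refine (measure_biUnion_null_iff hfin.countable).2 fun a _ =>
        (measure_biUnion_null_iff hfin.countable).2 fun b _ =>
        (measure_biUnion_null_iff hfin.countable).2 fun c _ => measure_iUnion_null fun habc =>
          volume_cospherical_eq_zero a b c habc
  have hUB : ¬ U ⊆ B := fun h =>
    (hU.measure_pos volume hne).ne' (measure_mono_null h hB)
  obtain ⟨w, hwU, hwB⟩ := Set.not_subset.1 hUB
  simp only [B, Set.mem_union, Set.mem_iUnion, Set.mem_ofPred_eq, not_or, not_exists] at hwB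
  refine ⟨w, hwU, hwB.1, hS.insert_point (fun a ha b hb hab => hwB.2.1 a ha b hb hab) ?_⟩
  intro a ha b hb c hc hab hac hbc
  exact hwB.2.2 a ha b hb c hc (hS.1 a ha b hb c hc hab hac hbc)

theorem InGeneralPosition.exists_image {ι : Type*} {S : Set Plane} (hS : InGeneralPosition S)
    (hfin : S.Finite) (U : ι → Set Plane) (hU : ∀ i, IsOpen (U i)) (s : Finset ι)
    (hne : ∀ i ∈ s, (U i).Nonempty) :
    ∃ f : ι → Plane, (∀ i ∈ s, f i ∈ U i) ∧ Set.InjOn f s ∧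
      InGeneralPosition (S ∪ f '' s) := by
  classical
  induction s using Finset.induction_on with
  | empty => exact ⟨fun _ => 0, by simp, by simp, by simpa using hS⟩
  | insert i s his ih =>
    obtain ⟨f, hf, hinj, hgp⟩ := ih fun j hj => hne j (Finset.mem_insert_of_mem hj)
    obtain ⟨w, hwU, hw, hwgp⟩ := hgp.exists_insert (hfin.union (s.finite_toSet.image f)) (hU i)
      (hne i (Finset.mem_insert_self i s))
    have heq : ∀ j ∈ s, Function.update f i w j = f j := fun j hj =>
      Function.update_of_ne (by rintro rfl; exact his hj) _ _
    have himg : Function.update f i w '' (s : Set ι) = f '' s := Set.image_congr heq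
    refine ⟨Function.update f i w, ?_, ?_, ?_⟩
    · intro j hj
      rcases Finset.mem_insert.1 hj with rfl | hj
      · simpa using hwU
      · rw [heq j hj]; exact hf j hj
    · rw [Finset.coe_insert, Set.injOn_insert (by simpa using his), himg]
      refine ⟨hinj.congr fun j hj => (heq j hj).symm, ?_⟩
      rw [Function.update_self]
      exact fun h => hw (Or.inr h)
    · rw [Finset.coe_insert, Set.image_insert_eq, himg, Function.update_self, Set.union_insert]
      exact hwgp

/-! ### Upper bound: two witnesses beside each point -/

theorem Plane.dist_sq (x y : Plane) :
    dist x y ^ 2 = (x 0 - y 0) ^ 2 + (x 1 - y 1) ^ 2 := by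
  rw [EuclideanSpace.dist_sq_eq, Fin.sum_univ_two, Real.dist_eq, Real.dist_eq, sq_abs, sq_abs]

theorem Plane.ext {x y : Plane} (h0 : x 0 = y 0) (h1 : x 1 = y 1) : x = y := by
  ext i
  fin_cases i
  · exact h0
  · exact h1

theorem Plane.mem_ball_iff {w c : Plane} {r : ℝ} (hr : 0 < r) :
    w ∈ Metric.ball c r ↔ (w 0 - c 0) ^ 2 + (w 1 - c 1) ^ 2 < r ^ 2 := by
  rw [Metric.mem_ball, ← Plane.dist_sq, sq_lt_sq₀ dist_nonneg hr.le]

theorem Plane.sq_of_mem_sphere {w c : Plane} {r : ℝ} (h : w ∈ Metric.sphere c r) :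
    (w 0 - c 0) ^ 2 + (w 1 - c 1) ^ 2 = r ^ 2 := by
  rw [← Plane.dist_sq, Metric.mem_sphere.1 h]

/-- Coordinate dot product. -/
def dot (x y : Plane) : ℝ := x 0 * y 0 + x 1 * y 1

/-- Coordinate cross product. -/
def cross (x y : Plane) : ℝ := x 0 * y 1 - x 1 * y 0

/-- With `p` as origin, `(x, y)` is `q`, `(s, t)` the centre, and `(a, b)`, `(d, e)` are the
witnesses relative to `p` and `q`. A witness in the diametral disk but outside the given disk must
lie on the side of `pq` away from the centre; two witnesses on opposite sides cannot both do so. -/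
theorem opposite_sides_real {a b d e x y s t : ℝ} (e1 : x ^ 2 + y ^ 2 = 2 * (x * s + y * t))
    (g1 : a * a + b * b < a * x + b * y) (g2 : d * d + e * e < - (d * x + e * y))
    (g3 : (x * b - y * a) * (x * e - y * d) < 0) (f1 : 2 * (a * s + b * t) ≤ a * a + b * b)
    (f2 : 2 * (d * (s - x) + e * (t - y)) ≤ d * d + e * e) : False := by
  have hxy : 0 < x ^ 2 + y ^ 2 := by
    by_contra hneg
    have hx0 : x = 0 := by nlinarith [sq_nonneg x, sq_nonneg y]
    have hy0 : y = 0 := by nlinarith [sq_nonneg x, sq_nonneg y]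
    simp [hx0, hy0] at g3
  -- `τ` measures the position of the centre on the bisector of the chord
  obtain ⟨τ, hτ⟩ : ∃ τ, τ = x * t - y * s := ⟨_, rfl⟩
  have i1 : (x ^ 2 + y ^ 2) * (2 * (a * s + b * t)) =
      (x ^ 2 + y ^ 2) * (a * x + b * y) + 2 * τ * (x * b - y * a) := by
    subst hτ
    linear_combination (-(a * x + b * y)) * e1
  have i2 : (x ^ 2 + y ^ 2) * (2 * (d * (s - x) + e * (t - y))) =
      - (x ^ 2 + y ^ 2) * (d * x + e * y) + 2 * τ * (x * e - y * d) := by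
    subst hτ
    linear_combination (-(d * x + e * y)) * e1
  have j1 : τ * (x * b - y * a) < 0 := by
    have := mul_lt_mul_of_pos_left (f1.trans_lt g1) hxy
    linarith
  have j2 : τ * (x * e - y * d) < 0 := by
    have := mul_lt_mul_of_pos_left (f2.trans_lt g2) hxy
    linarith
  have j3 := mul_pos_of_neg_of_neg j1 j2
  have j4 : τ ^ 2 * ((x * b - y * a) * (x * e - y * d)) ≤ 0 :=
    mul_nonpos_of_nonneg_of_nonpos (sq_nonneg _) g3.le
  linarith

/-- `h₁` and `h₂` place the witnesses inside the circle with diameter `pq`, by Thales; `hc`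
separates them by the line `pq`. -/
theorem mem_ball_or_mem_ball {p q w₁ w₂ c : Plane} {r : ℝ} (hr : 0 < r)
    (hp : p ∈ Metric.sphere c r) (hq : q ∈ Metric.sphere c r)
    (h₁ : dot (w₁ - p) (w₁ - p) < dot (w₁ - p) (q - p))
    (h₂ : dot (w₂ - q) (w₂ - q) < dot (w₂ - q) (p - q))
    (hc : cross (q - p) (w₁ - p) * cross (q - p) (w₂ - q) < 0) :
    w₁ ∈ Metric.ball c r ∨ w₂ ∈ Metric.ball c r := by
  rw [Plane.mem_ball_iff hr, Plane.mem_ball_iff hr]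
  have hp' := Plane.sq_of_mem_sphere hp
  have hq' := Plane.sq_of_mem_sphere hq
  by_contra! hcon
  obtain ⟨k₁, k₂⟩ := hcon
  simp only [dot, cross, PiLp.sub_apply] at h₁ h₂ hc
  refine opposite_sides_real (a := w₁ 0 - p 0) (b := w₁ 1 - p 1) (d := w₂ 0 - q 0)
    (e := w₂ 1 - q 1) (x := q 0 - p 0) (y := q 1 - p 1) (s := c 0 - p 0) (t := c 1 - p 1)
    ?_ h₁ ?_ hc ?_ ?_
  · linarith only [hp', hq']
  · linarith only [h₂]
  · linarith only [hp', k₁]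
  · linarith only [hq', k₂]

/-- The places for a witness next to `p`, for the points of `P` on the side of `p` to which `u`
points. -/
def witnessRegion (P : Finset Plane) (p u : Plane) : Set Plane :=
  {w | ∀ q ∈ P, 0 < dot (q - p) u → dot (w - p) (w - p) < dot (w - p) (q - p) ∧
    0 < cross (q - p) (w - p) * cross (q - p) u}

theorem isOpen_witnessRegion (P : Finset Plane) (p u : Plane) :
    IsOpen (witnessRegion P p u) := by
  have : witnessRegion P p u = ⋂ q ∈ P, {w | 0 < dot (q - p) u →
      dot (w - p) (w - p) < dot (w - p) (q - p) ∧
      0 < cross (q - p) (w - p) * cross (q - p) u} := by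
    ext w; simp [witnessRegion]
  rw [this]
  refine isOpen_biInter_finset fun q _ => ?_
  by_cases hq : 0 < dot (q - p) u
  · simp only [hq, forall_const]
    have h1 : IsOpen {w : Plane | dot (w - p) (w - p) < dot (w - p) (q - p)} := by
      simp only [dot, PiLp.sub_apply]
      exact isOpen_lt (by fun_prop) (by fun_prop)
    have h2 : IsOpen {w : Plane | 0 < cross (q - p) (w - p) * cross (q - p) u} := by
      simp only [cross, PiLp.sub_apply]
      exact isOpen_lt (by fun_prop) (by fun_prop)
    exact h1.inter h2
  · simp [hq]

/-- The point `p + ε • u` works for small `ε > 0`: the quadratic term in `ε` is dominated by the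
linear one. -/
theorem witnessRegion_nonempty (P : Finset Plane) (p u : Plane)
    (hu : ∀ q ∈ P, q ≠ p → cross (q - p) u ≠ 0) : (witnessRegion P p u).Nonempty := by
  have h : ∀ q ∈ P, ∀ᶠ ε : ℝ in nhdsWithin 0 (Set.Ioi 0), 0 < dot (q - p) u →
      dot (ε • u) (ε • u) < dot (ε • u) (q - p) ∧
      0 < cross (q - p) (ε • u) * cross (q - p) u := by
    intro q hq
    by_cases hd : 0 < dot (q - p) u
    · have hcr : cross (q - p) u ≠ 0 := hu q hq fun h => by simp [h, dot] at hd
      have hsmall : ∀ᶠ ε : ℝ in nhdsWithin 0 (Set.Ioi 0), ε * dot u u < dot (q - p) u := by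
        apply Filter.Eventually.filter_mono nhdsWithin_le_nhds
        have : Continuous fun ε : ℝ => ε * dot u u := by fun_prop
        exact (this.tendsto' 0 0 (by simp)).eventually_lt_const hd
      filter_upwards [hsmall, self_mem_nhdsWithin] with ε hε hpos _
      have hpos' : 0 < ε := hpos
      constructor
      · have := mul_lt_mul_of_pos_left hε hpos'
        simp only [dot, PiLp.sub_apply, PiLp.smul_apply, smul_eq_mul] at this ⊢
        linarith
      · have e : cross (q - p) (ε • u) * cross (q - p) u = ε * cross (q - p) u ^ 2 := by
          simp only [cross, PiLp.sub_apply, PiLp.smul_apply, smul_eq_mul]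
          ring
        rw [e]
        positivity
    · exact Filter.Eventually.of_forall fun _ h => absurd h hd
  obtain ⟨ε, hε⟩ := ((Filter.eventually_all_finset P).2 h).exists
  refine ⟨p + ε • u, fun q hq hd => ?_⟩
  rw [add_sub_cancel_left]
  exact hε q hq hd

theorem exists_generic_direction (P : Finset Plane) :
    ∃ u : Plane, ∀ p ∈ P, ∀ q ∈ P, p ≠ q → dot (q - p) u ≠ 0 ∧ cross (q - p) u ≠ 0 := by
  classical
  -- The values of `s` for which `(1, s)` is perpendicular or parallel to a line through two points
  -- of `P`.
  let B : Finset ℝ := (P ×ˢ P).image (fun z => -(z.2 0 - z.1 0) / (z.2 1 - z.1 1)) ∪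
    (P ×ˢ P).image (fun z => (z.2 1 - z.1 1) / (z.2 0 - z.1 0))
  obtain ⟨s, hs⟩ := Set.Infinite.exists_notMem_finset (Set.Ioi_infinite (0 : ℝ)) B
  obtain ⟨hs0, hs⟩ := hs
  have hs0 : 0 < s := hs0
  refine ⟨!₂[1, s], fun p hp q hq hpq => ⟨fun h => ?_, fun h => ?_⟩⟩
  · simp [dot] at h
    by_cases h1 : q 1 - p 1 = 0
    · exact hpq (Plane.ext (by simp [h1] at h; linarith) (by linarith))
    · refine hs (Finset.mem_union_left _ (Finset.mem_image.2 ⟨(p, q), by simp [hp, hq], ?_⟩))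
      rw [div_eq_iff h1]; simp only; linarith
  · simp [cross] at h
    by_cases h1 : q 0 - p 0 = 0
    · exact hpq (Plane.ext (by linarith) (by simp [h1] at h; linarith))
    · refine hs (Finset.mem_union_right _ (Finset.mem_image.2 ⟨(p, q), by simp [hp, hq], ?_⟩))
      rw [div_eq_iff h1]; simp only; linarith

theorem card_filter_exists_dot_lt (P : Finset Plane) (hP : P.Nonempty) (u : Plane)
    [DecidablePred fun p => ∃ q ∈ P, 0 < dot (q - p) u] :
    (P.filter fun p => ∃ q ∈ P, 0 < dot (q - p) u).card ≤ P.card - 1 := by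
  classical
  obtain ⟨m, hm, hmax⟩ := P.exists_max_image (fun p => dot p u) hP
  rw [← Finset.card_erase_of_mem hm]
  refine Finset.card_le_card fun p hp => ?_
  obtain ⟨hpP, q, hq, hd⟩ := Finset.mem_filter.1 hp
  refine Finset.mem_erase.2 ⟨?_, hpP⟩
  rintro rfl
  have := hmax q hq
  simp only [dot, PiLp.sub_apply] at this hd
  linarith

theorem exists_stabbing_set (P : Finset Plane) (hne : P.Nonempty)
    (hP : InGeneralPosition (P : Set Plane)) :
    ∃ W : Finset Plane, InGeneralPosition ((P : Set Plane) ∪ W) ∧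
      IsStabbingSet W (diskFamily P) ∧ W.card ≤ 2 * P.card - 2 := by
  classical
  obtain ⟨u, hu⟩ := exists_generic_direction P
  have hneg : ∀ x : Plane, cross x (-u) = - cross x u := fun x => by
    simp [cross]; ring
  let F (v : Plane) : Finset Plane := P.filter fun p => ∃ q ∈ P, 0 < dot (q - p) v
  obtain ⟨f, hf, -, hgp⟩ := hP.exists_image P.finite_toSet
    (fun p => witnessRegion P p u) (fun p => isOpen_witnessRegion P p u) (F u)
    fun p hp => witnessRegion_nonempty P p u fun q hq hqp =>
      (hu p (Finset.mem_filter.1 hp).1 q hq hqp.symm).2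
  obtain ⟨g, hg, -, hgp'⟩ := hgp.exists_image
    (P.finite_toSet.union ((F u).finite_toSet.image f))
    (fun p => witnessRegion P p (-u)) (fun p => isOpen_witnessRegion P p (-u)) (F (-u))
    fun p hp => witnessRegion_nonempty P p (-u) fun q hq hqp => by
      rw [hneg, neg_ne_zero]
      exact (hu p (Finset.mem_filter.1 hp).1 q hq hqp.symm).2
  refine ⟨(F u).image f ∪ (F (-u)).image g, ?_, ?_, ?_⟩
  · rw [Finset.coe_union, Finset.coe_image, Finset.coe_image, ← Set.union_assoc]
    exact hgp'
  · rintro _ ⟨c, r, hr, rfl, p, hp, q, hq, hpq, hps, hqs⟩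
    have key : ∀ p ∈ P, ∀ q ∈ P, p ∈ Metric.sphere c r → q ∈ Metric.sphere c r →
        0 < dot (q - p) u → ∃ w ∈ (((F u).image f ∪ (F (-u)).image g : Finset Plane) : Set Plane),
          Stabs w (Metric.closedBall c r) := by
      intro p hp q hq hps hqs hd
      have hd' : 0 < dot (p - q) (-u) := by
        simp only [dot, PiLp.sub_apply, PiLp.neg_apply] at hd ⊢
        linarith
      have hpF : p ∈ F u := Finset.mem_filter.2 ⟨hp, q, hq, hd⟩
      have hqF : q ∈ F (-u) := Finset.mem_filter.2 ⟨hq, p, hp, hd'⟩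
      obtain ⟨a1, a2⟩ := hf p hpF q hq hd
      obtain ⟨b1, b2⟩ := hg q hqF p hp hd'
      -- `f p` is on the side of `pq` to which `u` points and `g q` on the side to which `-u`
      -- points.
      have hc : cross (q - p) (f p - p) * cross (q - p) (g q - q) < 0 := by
        have b3 : cross (q - p) (g q - q) * cross (q - p) u < 0 := by
          have : cross (p - q) (g q - q) * cross (p - q) (-u) =
              - (cross (q - p) (g q - q) * cross (q - p) u) := by
            simp only [cross, PiLp.sub_apply, PiLp.neg_apply]; ring
          linarith
        have := mul_neg_of_pos_of_neg a2 b3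
        by_contra hcon
        have := mul_nonneg (not_lt.1 hcon) (sq_nonneg (cross (q - p) u))
        linarith
      simp only [Stabs, interior_closedBall c hr.ne']
      rcases mem_ball_or_mem_ball hr hps hqs a1 b1 hc with h | h
      · exact ⟨f p, by simpa using Or.inl ⟨p, hpF, rfl⟩, h⟩
      · exact ⟨g q, by simpa using Or.inr ⟨q, hqF, rfl⟩, h⟩
    rcases lt_or_gt_of_ne (hu p hp q hq hpq).1 with h | h
    · refine key q hq p hp hqs hps ?_
      simp only [dot, PiLp.sub_apply] at h ⊢
      linarith
    · exact key p hp q hq hps hqs h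
  · have h1 : (F u).card ≤ P.card - 1 := card_filter_exists_dot_lt P hne u
    have h2 : (F (-u)).card ≤ P.card - 1 := card_filter_exists_dot_lt P hne (-u)
    have h3 := Finset.card_union_le ((F u).image f) ((F (-u)).image g)
    have h4 := Finset.card_image_le (s := F u) (f := f)
    have h5 := Finset.card_image_le (s := F (-u)) (f := g)
    omega

/-! ### Lower bound: chains of tangent disks -/

open Filter Topology

/-- The factor by which the radius grows from a disk centred at `o` with `a` on its boundary to the
disk through `a` and `b` that is tangent to it at `a`; it is positive for external tangency. -/
noncomputable def tangentRatio (o a b : Plane) : ℝ :=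
  dist a b ^ 2 / (2 * dot (a - o) (b - a))

/-- The centre of the circle through `a` and `b` that is tangent at `a` to the circle around `o`
through `a`. -/
noncomputable def tangentStep (o a b : Plane) : Plane :=
  a + tangentRatio o a b • (a - o)

theorem dist_tangentStep {o a b : Plane} (h : 0 < tangentRatio o a b) :
    dist (tangentStep o a b) b = dist (tangentStep o a b) a := by
  -- Division by zero yields ratio `0`, so a positive ratio forces a nonzero denominator.
  have hD : 2 * dot (a - o) (b - a) ≠ 0 := by
    intro h0
    simp [tangentRatio, h0] at h
  have hr : tangentRatio o a b * (2 * dot (a - o) (b - a)) = dist a b ^ 2 :=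
    div_mul_cancel₀ _ hD
  rw [← sq_eq_sq₀ dist_nonneg dist_nonneg, Plane.dist_sq, Plane.dist_sq, tangentStep]
  rw [Plane.dist_sq] at hr
  simp only [dot, PiLp.add_apply, PiLp.sub_apply, PiLp.smul_apply, smul_eq_mul] at hr ⊢
  linear_combination -hr

theorem dist_tangentStep_pos {o a b : Plane} (h : 0 < tangentRatio o a b) :
    0 < dist (tangentStep o a b) a := by
  have ha : a - o ≠ 0 := by
    intro h0
    simp [tangentRatio, h0, dot] at h
  rw [tangentStep, dist_eq_norm, add_sub_cancel_left]
  exact norm_pos_iff.2 (smul_ne_zero h.ne' ha)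

theorem disjoint_ball_tangentStep {o a b : Plane} (h : 0 < tangentRatio o a b) :
    Disjoint (Metric.ball o (dist o a))
      (Metric.ball (tangentStep o a b) (dist (tangentStep o a b) a)) := by
  apply Metric.ball_disjoint_ball
  have e1 : tangentStep o a b - a = tangentRatio o a b • (a - o) := by
    rw [tangentStep, add_sub_cancel_left]
  have e2 : tangentStep o a b - o = (1 + tangentRatio o a b) • (a - o) := by
    rw [tangentStep, add_smul, one_smul]; abel
  rw [dist_comm o a, dist_comm o, dist_eq_norm, dist_eq_norm, dist_eq_norm, e1, e2, norm_smul,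
    norm_smul, Real.norm_of_nonneg h.le, Real.norm_of_nonneg (by linarith)]
  linarith

theorem ContinuousAt.tangentRatio {X : Type*} [TopologicalSpace X] {f g h : X → Plane} {x : X}
    (hf : ContinuousAt f x) (hg : ContinuousAt g x) (hh : ContinuousAt h x)
    (hd : dot (g x - f x) (h x - g x) ≠ 0) :
    ContinuousAt (fun y => tangentRatio (f y) (g y) (h y)) x := by
  refine ((hg.dist hh).pow 2).div ?_ (mul_ne_zero two_ne_zero hd)
  have hdot : Continuous fun z : Plane × Plane => 2 * dot z.1 z.2 := by
    unfold dot; fun_prop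
  exact hdot.continuousAt.comp (f := fun y => (g y - f y, h y - g y))
    ((hg.sub hf).prodMk (hh.sub hg))

theorem ContinuousAt.tangentStep {X : Type*} [TopologicalSpace X] {f g h : X → Plane} {x : X}
    (hf : ContinuousAt f x) (hg : ContinuousAt g x) (hh : ContinuousAt h x)
    (hd : dot (g x - f x) (h x - g x) ≠ 0) :
    ContinuousAt (fun y => tangentStep (f y) (g y) (h y)) x :=
  hg.add ((hf.tangentRatio hg hh hd).smul (hg.sub hf))

/-- The centres of a chain of circles, the `k`-th one through `q k` and `q (k + 1)`, each tangent
to the preceding one, and the first one tangent to the circle around `o` through `q 0`. -/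
noncomputable def tangentChain (o : Plane) (q : ℕ → Plane) : ℕ → Plane
  | 0 => tangentStep o (q 0) (q 1)
  | k + 1 => tangentStep (tangentChain o q k) (q (k + 1)) (q (k + 2))

/-- The centres of a closed ring of `n` disks of radius `ρ`, consecutive ones tangent and the
others disjoint. -/
structure CoinRing (n : ℕ) (ρ : ℝ) (c : ℕ → Plane) : Prop where
  pos : 0 < ρ
  periodic : ∀ k, c (k + n) = c k
  tangent : ∀ k, dist (c k) (c (k + 1)) = 2 * ρ
  apart : ∀ j m, 2 ≤ m → m + 2 ≤ n → 2 * ρ < dist (c j) (c (j + m))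

/-- The points of contact of consecutive disks of a ring. -/
noncomputable def contact (c : ℕ → Plane) (k : ℕ) : Plane := midpoint ℝ (c k) (c (k + 1))

theorem Plane.midpoint_apply (x y : Plane) (i : Fin 2) :
    (midpoint ℝ x y) i = (x i + y i) / 2 := by
  rw [midpoint_eq_smul_add]
  simp
  ring

/-! ### Rings of tangent disks and their perturbations -/

namespace CoinRing

variable {n : ℕ} {ρ : ℝ} {c : ℕ → Plane}

theorem shift (hc : CoinRing n ρ c) (i : ℕ) : CoinRing n ρ fun k => c (i + k) where
  pos := hc.pos
  periodic k := by simpa only [add_assoc] using hc.periodic (i + k)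
  tangent k := hc.tangent (i + k)
  apart j m h1 h2 := by simpa only [add_assoc] using hc.apart (i + j) m h1 h2

theorem ne_add_two (hc : CoinRing n ρ c) (hn : 3 ≤ n) (k : ℕ) : c k ≠ c (k + 2) := by
  have hρ := hc.pos
  intro h
  rcases hn.eq_or_lt with rfl | hn
  · have := hc.tangent (k + 2)
    rw [show k + 2 + 1 = k + 3 by rfl, hc.periodic, h, dist_self] at this
    linarith
  · have := hc.apart k 2 le_rfl (by omega)
    rw [h, dist_self] at this
    linarith

theorem dist_contact_left (hc : CoinRing n ρ c) (k : ℕ) : dist (c k) (contact c k) = ρ := by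
  rw [contact, dist_left_midpoint, hc.tangent]
  norm_num
  ring

theorem dist_contact_right (hc : CoinRing n ρ c) (k : ℕ) :
    dist (c (k + 1)) (contact c k) = ρ := by
  rw [contact, dist_comm, dist_midpoint_right, hc.tangent]
  norm_num
  ring

theorem contact_periodic (hc : CoinRing n ρ c) (k : ℕ) : contact c (k + n) = contact c k := by
  rw [contact, contact, hc.periodic, add_right_comm, hc.periodic]

theorem contact_succ_ne (hc : CoinRing n ρ c) (hn : 3 ≤ n) (k : ℕ) :
    contact c k ≠ contact c (k + 1) := by
  intro h
  rw [contact, contact, midpoint_comm, midpoint_eq_midpoint_iff_vsub_eq_vsub] at h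
  refine hc.ne_add_two hn k ?_
  exact (sub_eq_zero.1 (by simpa using h.symm)).symm

theorem contact_ne (hc : CoinRing n ρ c) (hn : 3 ≤ n) {j k : ℕ} (hjk : j < k) (hk : k < n) :
    contact c j ≠ contact c k := by
  obtain ⟨m, rfl⟩ := Nat.exists_eq_add_of_lt hjk
  rcases Nat.eq_zero_or_pos m with rfl | hm
  · exact hc.contact_succ_ne hn j
  · intro h
    by_cases h2 : m + 1 + 2 ≤ n
    · have h3 := hc.apart j (m + 1) (by omega) h2
      have h4 := dist_triangle_right (c j) (c (j + (m + 1))) (contact c j)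
      have h5 := hc.dist_contact_left (j + (m + 1))
      rw [← add_assoc, ← h, add_assoc] at h5
      rw [hc.dist_contact_left, h5] at h4
      linarith
    -- Only the pair `0`, `n - 1` remains, which is consecutive cyclically.
    · obtain rfl : j = 0 := by omega
      have h6 := hc.contact_succ_ne hn (0 + m + 1)
      rw [← h, show 0 + m + 1 + 1 = 0 + n by omega, hc.contact_periodic] at h6
      exact h6 rfl

theorem dot_contact (hc : CoinRing n ρ c) (k : ℕ) :
    2 * dot (contact c k - c k) (contact c (k + 1) - contact c k) =
      dist (contact c k) (contact c (k + 1)) ^ 2 := by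
  have h1 : dist (c (k + 1)) (contact c k) ^ 2 = dist (c (k + 1)) (contact c (k + 1)) ^ 2 := by
    rw [hc.dist_contact_right, hc.dist_contact_left]
  simp only [Plane.dist_sq, contact, Plane.midpoint_apply, dot, PiLp.sub_apply] at h1 ⊢
  linear_combination h1

theorem dot_contact_ne_zero (hc : CoinRing n ρ c) (hn : 3 ≤ n) (k : ℕ) :
    dot (contact c k - c k) (contact c (k + 1) - contact c k) ≠ 0 := by
  intro h
  have h1 := hc.dot_contact k
  rw [h, mul_zero, eq_comm, sq_eq_zero_iff, dist_eq_zero] at h1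
  exact hc.contact_succ_ne hn k h1

theorem tangentRatio_contact (hc : CoinRing n ρ c) (hn : 3 ≤ n) (k : ℕ) :
    tangentRatio (c k) (contact c k) (contact c (k + 1)) = 1 := by
  rw [tangentRatio, ← hc.dot_contact]
  exact div_self (mul_ne_zero two_ne_zero (hc.dot_contact_ne_zero hn k))

theorem tangentStep_contact (hc : CoinRing n ρ c) (hn : 3 ≤ n) (k : ℕ) :
    tangentStep (c k) (contact c k) (contact c (k + 1)) = c (k + 1) := by
  rw [tangentStep, hc.tangentRatio_contact hn, one_smul, contact]
  apply Plane.ext <;>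
  · simp only [PiLp.add_apply, PiLp.sub_apply, Plane.midpoint_apply]
    ring

/-- On the unperturbed contact points the chain reproduces the ring itself, one index ahead because
its first disk lies beyond `contact c 0`. -/
theorem tangentChain_contact (hc : CoinRing n ρ c) (hn : 3 ≤ n) (k : ℕ) :
    tangentChain (c 0) (contact c) k = c (k + 1) := by
  induction k with
  | zero => exact hc.tangentStep_contact hn 0
  | succ k ih => rw [tangentChain, ih]; exact hc.tangentStep_contact hn (k + 1)

theorem continuousAt_tangentChain (hc : CoinRing n ρ c) (hn : 3 ≤ n) (k : ℕ) :
    ContinuousAt (fun q => tangentChain (c 0) q k) (contact c) := by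
  induction k with
  | zero =>
    exact continuousAt_const.tangentStep (continuous_apply 0).continuousAt
      (continuous_apply 1).continuousAt (hc.dot_contact_ne_zero hn 0)
  | succ k ih =>
    refine ih.tangentStep (continuous_apply (k + 1)).continuousAt
      (continuous_apply (k + 2)).continuousAt ?_
    rw [hc.tangentChain_contact hn]
    exact hc.dot_contact_ne_zero hn (k + 1)

theorem tendsto_tangentChain (hc : CoinRing n ρ c) (hn : 3 ≤ n) (k : ℕ) :
    Tendsto (fun q => tangentChain (c 0) q k) (𝓝 (contact c)) (𝓝 (c (k + 1))) := by
  have := (hc.continuousAt_tangentChain hn k).tendsto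
  rwa [hc.tangentChain_contact hn] at this

theorem tendsto_radius (hc : CoinRing n ρ c) (hn : 3 ≤ n) (k : ℕ) :
    Tendsto (fun q => dist (tangentChain (c 0) q k) (q k)) (𝓝 (contact c)) (𝓝 ρ) := by
  have := (hc.tendsto_tangentChain hn k).dist (continuous_apply k).continuousAt.tendsto
  rwa [hc.dist_contact_right] at this

theorem eventually_tangentRatio_zero (hc : CoinRing n ρ c) (hn : 3 ≤ n) :
    ∀ᶠ q in 𝓝 (contact c), 0 < tangentRatio (c 0) (q 0) (q 1) := by
  have h : ContinuousAt (fun q : ℕ → Plane => tangentRatio (c 0) (q 0) (q 1)) (contact c) :=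
    continuousAt_const.tangentRatio (continuous_apply 0).continuousAt
      (continuous_apply 1).continuousAt (hc.dot_contact_ne_zero hn 0)
  refine h.tendsto.eventually_const_lt ?_
  rw [hc.tangentRatio_contact hn 0]
  exact one_pos

theorem eventually_tangentRatio_succ (hc : CoinRing n ρ c) (hn : 3 ≤ n) (k : ℕ) :
    ∀ᶠ q in 𝓝 (contact c),
      0 < tangentRatio (tangentChain (c 0) q k) (q (k + 1)) (q (k + 2)) := by
  have h := (hc.continuousAt_tangentChain hn k).tangentRatio
    (continuous_apply (k + 1)).continuousAt (continuous_apply (k + 2)).continuousAt (by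
      rw [hc.tangentChain_contact hn]
      exact hc.dot_contact_ne_zero hn (k + 1))
  refine h.tendsto.eventually_const_lt ?_
  rw [hc.tangentChain_contact hn, hc.tangentRatio_contact hn (k + 1)]
  exact one_pos

theorem eventually_radius (hc : CoinRing n ρ c) (hn : 3 ≤ n) (k : ℕ) :
    ∀ᶠ q in 𝓝 (contact c), 0 < dist (tangentChain (c 0) q k) (q k) ∧
      dist (tangentChain (c 0) q k) (q (k + 1)) = dist (tangentChain (c 0) q k) (q k) := by
  cases k with
  | zero =>
    filter_upwards [hc.eventually_tangentRatio_zero hn] with q hq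
    exact ⟨dist_tangentStep_pos hq, dist_tangentStep hq⟩
  | succ k =>
    filter_upwards [hc.eventually_tangentRatio_succ hn k] with q hq
    exact ⟨dist_tangentStep_pos hq, dist_tangentStep hq⟩

/-- Tangency is built into the chain, so consecutive disks stay disjoint under perturbation;
nonconsecutive ones do so by the strict inequality in `apart`. -/
theorem eventually_disjoint_succ (hc : CoinRing n ρ c) (hn : 3 ≤ n) (k : ℕ) :
    ∀ᶠ q in 𝓝 (contact c), Disjoint
      (Metric.ball (tangentChain (c 0) q k) (dist (tangentChain (c 0) q k) (q k)))
      (Metric.ball (tangentChain (c 0) q (k + 1))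
        (dist (tangentChain (c 0) q (k + 1)) (q (k + 1)))) := by
  filter_upwards [hc.eventually_tangentRatio_succ hn k, hc.eventually_radius hn k] with q hq hr
  rw [← hr.2]
  exact disjoint_ball_tangentStep hq

theorem eventually_disjoint (hc : CoinRing n ρ c) (hn : 3 ≤ n) (j m : ℕ) (hm : 2 ≤ m)
    (hmn : m + 2 ≤ n) :
    ∀ᶠ q in 𝓝 (contact c), Disjoint
      (Metric.ball (tangentChain (c 0) q j) (dist (tangentChain (c 0) q j) (q j)))
      (Metric.ball (tangentChain (c 0) q (j + m))
        (dist (tangentChain (c 0) q (j + m)) (q (j + m)))) := by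
  have h1 := (hc.tendsto_radius hn j).add (hc.tendsto_radius hn (j + m))
  have h2 := (hc.tendsto_tangentChain hn j).dist (hc.tendsto_tangentChain hn (j + m))
  have h3 := hc.apart (j + 1) m hm hmn
  rw [add_right_comm] at h3
  filter_upwards [h1.eventually_lt h2 (by linarith)] with q hq
  exact Metric.ball_disjoint_ball hq.le

/-- The last and first disks tend to the tangent disks around `c 0` and `c 1`. The median formula
bounds the distance from a common point to the midpoint of the centres by a quantity tending to `0`.
-/
theorem eventually_lens (hc : CoinRing n ρ c) (hn : 3 ≤ n) {η : ℝ} (hη : 0 < η) :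
    ∀ᶠ q in 𝓝 (contact c), ∀ w,
      w ∈ Metric.ball (tangentChain (c 0) q 0) (dist (tangentChain (c 0) q 0) (q 0)) →
      w ∈ Metric.ball (tangentChain (c 0) q (n - 1))
        (dist (tangentChain (c 0) q (n - 1)) (q (n - 1))) →
      w ∈ Metric.ball (contact c 0) η := by
  have hlast : c (n - 1 + 1) = c 0 := by
    rw [Nat.sub_add_cancel (by omega), ← hc.periodic 0, zero_add]
  have t0 := hc.tendsto_tangentChain hn 0
  have t1 := hc.tendsto_tangentChain hn (n - 1)
  rw [hlast] at t1
  have hmid : Tendsto (fun q => midpoint ℝ (tangentChain (c 0) q 0) (tangentChain (c 0) q (n - 1)))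
      (𝓝 (contact c)) (𝓝 (contact c 0)) := by
    rw [contact, midpoint_comm, midpoint_eq_smul_add]
    simp_rw [midpoint_eq_smul_add]
    exact (t0.add t1).const_smul _
  have hrad : Tendsto (fun q => (dist (tangentChain (c 0) q 0) (q 0) ^ 2 +
      dist (tangentChain (c 0) q (n - 1)) (q (n - 1)) ^ 2) / 2 -
      dist (tangentChain (c 0) q 0) (tangentChain (c 0) q (n - 1)) ^ 2 / 4)
      (𝓝 (contact c)) (𝓝 0) := by
    have := (((hc.tendsto_radius hn 0).pow 2).add ((hc.tendsto_radius hn (n - 1)).pow 2)).div_const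
      2 |>.sub (((t0.dist t1).pow 2).div_const 4)
    rw [dist_comm (c (0 + 1)), hc.tangent] at this
    convert this using 2
    ring
  filter_upwards [Metric.tendsto_nhds.1 hmid (η / 2) (half_pos hη),
    hrad.eventually_lt_const (show 0 < (η / 2) ^ 2 by positivity)] with q h1 h2 w hw0 hw1
  generalize tangentChain (c 0) q 0 = a at *
  generalize tangentChain (c 0) q (n - 1) = b at *
  rw [Metric.mem_ball] at hw0 hw1 ⊢
  have e : dist w (midpoint ℝ a b) ^ 2 = (dist w a ^ 2 + dist w b ^ 2) / 2 - dist a b ^ 2 / 4 := by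
    simp only [Plane.dist_sq, Plane.midpoint_apply]
    ring
  have k0 := pow_lt_pow_left₀ hw0 dist_nonneg two_ne_zero
  have k1 := pow_lt_pow_left₀ hw1 dist_nonneg two_ne_zero
  have k2 : dist w (midpoint ℝ a b) < η / 2 := by
    rw [← sq_lt_sq₀ dist_nonneg (half_pos hη).le, e]
    linarith
  linarith [dist_triangle w (midpoint ℝ a b) (contact c 0)]

/-- Near a ring of disks, the disks of the tangent chain overlap only close to the first point. -/
theorem eventually_tangentChain (hc : CoinRing n ρ c) (hn : 3 ≤ n) {η : ℝ} (hη : 0 < η) :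
    ∀ᶠ q in 𝓝 (contact c),
      (∀ k < n, 0 < dist (tangentChain (c 0) q k) (q k) ∧
        dist (tangentChain (c 0) q k) (q (k + 1)) = dist (tangentChain (c 0) q k) (q k)) ∧
      ∀ j < n, ∀ k < n, j < k → ∀ w,
        w ∈ Metric.ball (tangentChain (c 0) q j) (dist (tangentChain (c 0) q j) (q j)) →
        w ∈ Metric.ball (tangentChain (c 0) q k) (dist (tangentChain (c 0) q k) (q k)) →
        w ∈ Metric.ball (contact c 0) η := by
  have h1 := (eventually_all_finset (Finset.range n)).2 fun k _ => hc.eventually_radius hn k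
  have h2 := (eventually_all_finset (Finset.range n)).2 fun k _ =>
    hc.eventually_disjoint_succ hn k
  have h3 := (eventually_all_finset (Finset.range n)).2 fun j _ =>
    (eventually_all_finset (Finset.Icc 2 (n - 2))).2 fun m hm =>
      hc.eventually_disjoint hn j m (Finset.mem_Icc.1 hm).1 (by have := Finset.mem_Icc.1 hm; omega)
  filter_upwards [h1, h2, h3, hc.eventually_lens hn hη] with q h1 h2 h3 h4
  refine ⟨fun k hk => h1 k (Finset.mem_range.2 hk), fun j hj k hk hjk w hwj hwk => ?_⟩
  obtain ⟨m, rfl⟩ := Nat.exists_eq_add_of_lt hjk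
  rcases Nat.eq_zero_or_pos m with rfl | hm
  · exact absurd hwk (Set.disjoint_left.1 (h2 j (Finset.mem_range.2 hj)) hwj)
  · by_cases hmn : m + 1 ≤ n - 2
    · exact absurd hwk (Set.disjoint_left.1 (h3 j (Finset.mem_range.2 hj) (m + 1)
        (Finset.mem_Icc.2 ⟨by omega, hmn⟩)) hwj)
    · obtain rfl : j = 0 := by omega
      rw [show 0 + m + 1 = n - 1 by omega] at hwk
      exact h4 w hwj hwk

theorem exists_separation (hc : CoinRing n ρ c) (hn : 3 ≤ n) :
    ∃ η > 0, ∀ i j : Fin n, i ≠ j →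
      Disjoint (Metric.ball (contact c i) η) (Metric.ball (contact c j) η) := by
  have h : ∀ i j : Fin n, ∀ᶠ η : ℝ in 𝓝[>] 0, i ≠ j →
      Disjoint (Metric.ball (contact c i) η) (Metric.ball (contact c j) η) := by
    intro i j
    by_cases hij : i = j
    · simp [hij]
    have hne : contact c i ≠ contact c j := by
      rcases lt_or_gt_of_ne hij with h | h
      · exact hc.contact_ne hn h j.2
      · exact (hc.contact_ne hn h i.2).symm
    have ht : Tendsto (fun η : ℝ => η + η) (𝓝[>] 0) (𝓝 0) :=
      ((continuous_id.add continuous_id).tendsto' 0 0 (by simp)).mono_left nhdsWithin_le_nhds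
    filter_upwards [ht.eventually_lt_const (dist_pos.2 hne)] with η hη _
    exact Metric.ball_disjoint_ball hη.le
  obtain ⟨η, h1, h2⟩ :=
    ((eventually_all.2 fun i => eventually_all.2 fun j => h i j).and self_mem_nhdsWithin).exists
  exact ⟨η, h2, h1⟩

theorem exists_card_le_of_isStabbingSet (hc : CoinRing n ρ c) (hn : 3 ≤ n) :
    ∃ P : Finset Plane, P.card = n ∧ InGeneralPosition (P : Set Plane) ∧
      ∀ W : Finset Plane, IsStabbingSet W (diskFamily P) → n ≤ W.card := by
  classical
  obtain ⟨η, hη, hsep⟩ := hc.exists_separation hn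
  have hn0 : 0 < n := by omega
  -- Reduction mod `n` turns an `n`-tuple into a periodic sequence, read from position `i`.
  let idx (i k : ℕ) : Fin n := ⟨(i + k) % n, Nat.mod_lt _ hn0⟩
  have hev : ∀ i : Fin n, ∀ᶠ f : Fin n → Plane in 𝓝 (fun j : Fin n => contact c j),
      (∀ k < n, 0 < dist (tangentChain (c i) (fun k => f (idx i k)) k) (f (idx i k)) ∧
        dist (tangentChain (c i) (fun k => f (idx i k)) k) (f (idx i (k + 1))) =
          dist (tangentChain (c i) (fun k => f (idx i k)) k) (f (idx i k))) ∧
      ∀ j < n, ∀ k < n, j < k → ∀ w,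
        w ∈ Metric.ball (tangentChain (c i) (fun k => f (idx i k)) j)
          (dist (tangentChain (c i) (fun k => f (idx i k)) j) (f (idx i j))) →
        w ∈ Metric.ball (tangentChain (c i) (fun k => f (idx i k)) k)
          (dist (tangentChain (c i) (fun k => f (idx i k)) k) (f (idx i k))) →
        w ∈ Metric.ball (contact c i) η := by
    intro i
    have ht : Tendsto (fun (f : Fin n → Plane) (k : ℕ) => f (idx i k))
        (𝓝 (fun j : Fin n => contact c j)) (𝓝 (contact fun k => c (i + k))) := by
      have hcont : Continuous fun (f : Fin n → Plane) (k : ℕ) => f (idx i k) := by fun_prop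
      refine hcont.tendsto' _ _ (funext fun k => ?_)
      exact Function.Periodic.map_mod_nat hc.contact_periodic (i + k)
    exact ht.eventually ((hc.shift i).eventually_tangentChain hn hη)
  obtain ⟨δ, hδ, hball⟩ := Metric.eventually_nhds_iff.1 (eventually_all.2 hev)
  obtain ⟨f, hf, hinj, hgp⟩ := inGeneralPosition_empty.exists_image Set.finite_empty
    (fun i : Fin n => Metric.ball (contact c i) δ) (fun _ => Metric.isOpen_ball) Finset.univ
    fun _ _ => Metric.nonempty_ball.2 hδ
  have hinj : Function.Injective f := by simpa [Set.injOn_univ] using hinj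
  replace hball := hball ((dist_pi_lt_iff hδ).2 fun i => hf i (Finset.mem_univ i))
  refine ⟨Finset.univ.image f, by simp [Finset.card_image_of_injective _ hinj],
    by simpa using hgp, fun W hW => ?_⟩
  by_contra! hcard
  have hlens : ∀ i : Fin n, ∃ w ∈ W, w ∈ Metric.ball (contact c i) η := by
    intro i
    obtain ⟨hrad, hover⟩ := hball i
    have hstab : ∀ k ∈ Finset.range n, ∃ w ∈ W,
        w ∈ Metric.ball (tangentChain (c i) (fun k => f (idx i k)) k)
          (dist (tangentChain (c i) (fun k => f (idx i k)) k) (f (idx i k))) := by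
      intro k hk
      obtain ⟨hr, hr'⟩ := hrad k (Finset.mem_range.1 hk)
      have hne : f (idx i k) ≠ f (idx i (k + 1)) := by
        intro h
        have h1 := congrArg Fin.val (hinj h)
        have h2 : (i + k + 1) ≡ (i + k + 0) [MOD n] := h1.symm
        have h3 := Nat.ModEq.add_left_cancel' _ h2
        rw [Nat.ModEq, Nat.mod_eq_of_lt (by omega), Nat.zero_mod] at h3
        omega
      obtain ⟨w, hw, hws⟩ := hW (Metric.closedBall _ _) ⟨_, _, hr, rfl, f (idx i k), by simp,
        f (idx i (k + 1)), by simp, hne, by rw [Metric.mem_sphere, dist_comm],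
        by rw [Metric.mem_sphere, dist_comm, hr']⟩
      rw [Stabs, interior_closedBall _ hr.ne'] at hws
      exact ⟨w, hw, hws⟩
    choose! g hgW hg using hstab
    -- Pigeonhole: two of the `n` chain disks share a stabbing point, which must lie near `contact c
    -- i`.
    obtain ⟨j, hj, k, hk, hjk, hgjk⟩ := Finset.exists_ne_map_eq_of_card_lt_of_maps_to
      (by simpa using hcard) hgW
    have hj' := Finset.mem_range.1 hj
    have hk' := Finset.mem_range.1 hk
    rcases lt_or_gt_of_ne hjk with h | h
    · exact ⟨g j, hgW j hj, hover j hj' k hk' h _ (hg j hj) (hgjk ▸ hg k hk)⟩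
    · exact ⟨g j, hgW j hj, hover k hk' j hj' h _ (hgjk ▸ hg k hk) (hg j hj)⟩
  choose g hgW hg using hlens
  have hginj : Function.Injective g := by
    intro i j hij
    by_contra hne
    exact Set.disjoint_left.1 (hsep i j hne) (hg i) (hij ▸ hg j)
  have := Finset.card_le_card_of_injOn (s := Finset.univ) g (fun i _ => hgW i) hginj.injOn
  rw [Finset.card_univ, Fintype.card_fin] at this
  omega

end CoinRing

/-! ### The regular polygon as a ring -/

/-- The vertices of a regular `n`-gon. -/
noncomputable def polygonVertex (n k : ℕ) : Plane :=
  !₂[Real.cos (2 * Real.pi * k / n), Real.sin (2 * Real.pi * k / n)]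

theorem dist_polygonVertex_sq (n j m : ℕ) :
    dist (polygonVertex n j) (polygonVertex n (j + m)) ^ 2 =
      2 - 2 * Real.cos (2 * Real.pi * m / n) := by
  have e : 2 * Real.pi * m / n =
      2 * Real.pi * ((j + m : ℕ) : ℝ) / n - 2 * Real.pi * j / n := by push_cast; ring
  rw [Plane.dist_sq, e, Real.cos_sub]
  simp only [polygonVertex]
  generalize 2 * Real.pi * ((j + m : ℕ) : ℝ) / n = x
  generalize 2 * Real.pi * (j : ℝ) / n = y
  simp
  linear_combination Real.sin_sq_add_cos_sq x + Real.sin_sq_add_cos_sq y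

theorem polygon_cos_lt {n m : ℕ} (hm : 2 ≤ m) (hmn : m + 2 ≤ n) :
    Real.cos (2 * Real.pi * m / n) < Real.cos (2 * Real.pi * (1 : ℕ) / n) := by
  have hπ := Real.pi_pos
  have hn : (0 : ℝ) < n := by exact_mod_cast (by omega : 0 < n)
  have hm' : (2 : ℝ) ≤ m := by exact_mod_cast hm
  have hmn' : (m : ℝ) + 2 ≤ n := by exact_mod_cast hmn
  have key : ∀ t : ℝ, 1 < t → t ≤ n / 2 →
      Real.cos (2 * Real.pi * t / n) < Real.cos (2 * Real.pi * (1 : ℕ) / n) := by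
    intro t h1 h2
    apply Real.cos_lt_cos_of_nonneg_of_le_pi (by positivity)
    · rw [div_le_iff₀ hn]; nlinarith
    · push_cast; gcongr
  -- Replacing `m` by `n - m` keeps the cosine and brings the angle into `[0, π]`, where cosine
  -- decreases.
  rcases le_total (m : ℝ) (n / 2) with h | h
  · exact key m (by linarith) h
  · have h1 := key (n - m) (by linarith) (by linarith)
    have e : 2 * Real.pi * (n - m) / n = 2 * Real.pi - 2 * Real.pi * m / n := by field_simp
    rwa [e, Real.cos_two_pi_sub] at h1

theorem coinRing_polygonVertex {n : ℕ} (hn : 3 ≤ n) :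
    CoinRing n (dist (polygonVertex n 0) (polygonVertex n 1) / 2) (polygonVertex n) := by
  have hn0 : (0 : ℝ) < n := by exact_mod_cast (by omega : 0 < n)
  have hn3 : (3 : ℝ) ≤ n := by exact_mod_cast hn
  have hπ := Real.pi_pos
  have h1 := dist_polygonVertex_sq n 0 1
  rw [zero_add] at h1
  refine ⟨?_, fun k => ?_, fun k => ?_, fun j m hm hmn => ?_⟩
  · have hlt : Real.cos (2 * Real.pi * (1 : ℕ) / n) < 1 := by
      rw [← Real.cos_zero]
      apply Real.cos_lt_cos_of_nonneg_of_le_pi le_rfl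
      · rw [div_le_iff₀ hn0]; push_cast; nlinarith
      · positivity
    have : 0 < dist (polygonVertex n 0) (polygonVertex n 1) := by
      rw [← sq_lt_sq₀ le_rfl dist_nonneg, h1, zero_pow two_ne_zero]
      linarith
    linarith
  · have e : 2 * Real.pi * ((k + n : ℕ) : ℝ) / n = 2 * Real.pi * k / n + 2 * Real.pi := by
      push_cast; field_simp
    rw [polygonVertex, polygonVertex, e, Real.cos_add_two_pi, Real.sin_add_two_pi]
  · rw [mul_div_cancel₀ _ two_ne_zero, ← sq_eq_sq₀ dist_nonneg dist_nonneg, h1,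
      dist_polygonVertex_sq]
  · rw [mul_div_cancel₀ _ two_ne_zero, ← sq_lt_sq₀ dist_nonneg dist_nonneg, h1,
      dist_polygonVertex_sq]
    linarith [polygon_cos_lt hm hmn]

/-! ### The case of two points, and the conclusion -/

theorem two_le_card_of_isStabbingSet {p q : Plane} (hpq : p ≠ q) (W : Finset Plane)
    (hgp : InGeneralPosition (({p, q} : Set Plane) ∪ W))
    (hW : IsStabbingSet W (diskFamily {p, q})) : 2 ≤ W.card := by
  -- the disks through `p` and `q`, parametrized by the position of the centre on the bisector
  let c (t : ℝ) : Plane := !₂[(p 0 + q 0) / 2 - t * (q 1 - p 1), (p 1 + q 1) / 2 + t * (q 0 - p 0)]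
  have hd : 0 < dist p q ^ 2 := by have := dist_pos.2 hpq; positivity
  have hcp : ∀ t, dist (c t) p ^ 2 = (1 / 4 + t ^ 2) * dist p q ^ 2 := fun t => by
    simp [Plane.dist_sq, c]; ring
  have hcq : ∀ t, dist (c t) q ^ 2 = (1 / 4 + t ^ 2) * dist p q ^ 2 := fun t => by
    simp [Plane.dist_sq, c]; ring
  have hstab : ∀ t, ∃ w ∈ W, dist w (c t) ^ 2 < dist (c t) p ^ 2 := by
    intro t
    have hr : 0 < dist (c t) p := by
      rw [← sq_lt_sq₀ le_rfl dist_nonneg, hcp, zero_pow two_ne_zero]; positivity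
    obtain ⟨w, hw, hws⟩ := hW (Metric.closedBall (c t) (dist (c t) p)) ⟨_, _, hr, rfl, p, by simp,
      q, by simp, hpq, by rw [Metric.mem_sphere, dist_comm], by
        rw [Metric.mem_sphere, dist_comm, ← sq_eq_sq₀ dist_nonneg dist_nonneg, hcp, hcq]⟩
    rw [Stabs, interior_closedBall _ hr.ne', Metric.mem_ball] at hws
    exact ⟨w, hw, pow_lt_pow_left₀ hws dist_nonneg two_ne_zero⟩
  by_contra! hcard
  obtain ⟨w, hw, hws⟩ := hstab 0
  have honly : ∀ v ∈ W, v = w := fun v hv =>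
    Finset.card_le_one.1 (by omega) v hv w hw
  have hall : ∀ t, dist w (c t) ^ 2 < dist (c t) p ^ 2 := fun t => by
    obtain ⟨v, hv, hvs⟩ := hstab t
    rwa [honly v hv] at hvs
  have hwp : w ≠ p := by
    rintro rfl
    rw [dist_comm] at hws
    exact lt_irrefl _ hws
  have hwq : w ≠ q := by
    rintro rfl
    rw [dist_comm, hcp, hcq] at hws
    exact lt_irrefl _ hws
  have hcross : cross (q - p) (w - p) ≠ 0 := by
    intro h0
    refine hgp.1 p (by simp) q (by simp) w (Or.inr hw) hpq hwp.symm hwq.symm ?_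
    rw [collinear_iff_of_mem (p₀ := p) (by simp)]
    refine ⟨q - p, ?_⟩
    rintro x (rfl | rfl | rfl)
    · exact ⟨0, by simp⟩
    · exact ⟨1, by simp⟩
    · refine ⟨dot (q - p) (x - p) / dist p q ^ 2, ?_⟩
      have h0' : (q 0 - p 0) * (x 1 - p 1) - (q 1 - p 1) * (x 0 - p 0) = 0 := h0
      have hd' : (p 0 - q 0) ^ 2 + (p 1 - q 1) ^ 2 ≠ 0 := by
        rw [← Plane.dist_sq]; exact hd.ne'
      rw [Plane.dist_sq]
      apply Plane.ext
      · simp [dot]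
        field_simp
        linear_combination (-(q 1 - p 1)) * h0'
      · simp [dot]
        field_simp
        linear_combination (q 0 - p 0) * h0'
  -- This parameter solves the linear equation in `t` saying that `w` lies on the circle around `c
  -- t` through `p` and `q`.
  have h := hall ((dot (w - p) (w - p) - dot (w - p) (q - p)) /
    (2 * cross (q - p) (w - p)))
  have ht : (dot (w - p) (w - p) - dot (w - p) (q - p)) / (2 * cross (q - p) (w - p)) *
      (2 * cross (q - p) (w - p)) = dot (w - p) (w - p) - dot (w - p) (q - p) :=
    div_mul_cancel₀ _ (mul_ne_zero two_ne_zero hcross)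
  generalize (dot (w - p) (w - p) - dot (w - p) (q - p)) / (2 * cross (q - p) (w - p)) = t at h ht
  simp [Plane.dist_sq, c] at h
  simp only [dot, cross, PiLp.sub_apply] at ht
  linarith

theorem exists_le_diskStabbingNumber {n : ℕ} (hn : 2 ≤ n) :
    ∃ P : Finset Plane, P.card = n ∧ InGeneralPosition (P : Set Plane) ∧
      (n : ℕ∞) ≤ diskStabbingNumber P := by
  rcases hn.eq_or_lt with rfl | hn
  · obtain ⟨f, -, hinj, hgp⟩ := inGeneralPosition_empty.exists_image Set.finite_empty
      (fun _ : Fin 2 => Set.univ) (fun _ => isOpen_univ) Finset.univ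
      fun _ _ => Set.univ_nonempty
    have hinj : Function.Injective f := by simpa [Set.injOn_univ] using hinj
    have hne : f 0 ≠ f 1 := hinj.ne (by decide)
    refine ⟨{f 0, f 1}, Finset.card_pair hne, hgp.mono ?_, ?_⟩
    · intro x hx
      simp at hx
      rcases hx with rfl | rfl <;> simp
    · refine le_iInf fun W => le_iInf fun hg => le_iInf fun hW => ?_
      rw [Finset.coe_pair] at hg hW
      exact_mod_cast two_le_card_of_isStabbingSet hne W hg hW
  · obtain ⟨P, hc, hP, h⟩ := (coinRing_polygonVertex hn).exists_card_le_of_isStabbingSet hn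
    exact ⟨P, hc, hP, le_iInf fun W => le_iInf fun _ => le_iInf fun hW => by
      exact_mod_cast h W hW⟩

theorem witnessDelaunayGraph_eq_bot_iff (P W : Set Plane) :
    witnessDelaunayGraph P W = ⊥ ↔ IsStabbingSet W (diskFamily P) := by
  constructor
  · rintro h _ ⟨c, r, hr, rfl, p, hp, q, hq, hpq, hps, hqs⟩
    by_contra! hcon
    have hadj : (witnessDelaunayGraph P W).Adj ⟨p, hp⟩ ⟨q, hq⟩ := by
      refine ⟨fun h => hpq (congrArg Subtype.val h), c, r, hr, hps, hqs, fun w hw hwb => ?_⟩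
      exact hcon w hw (by rwa [Stabs, interior_closedBall c hr.ne'])
    rw [h] at hadj
    exact hadj
  · intro h
    ext x y
    refine ⟨?_, fun h => h.elim⟩
    rintro ⟨hne, c, r, hr, hx, hy, hw⟩
    obtain ⟨w, hwW, hws⟩ := h (Metric.closedBall c r)
      ⟨c, r, hr, rfl, x, x.2, y, y.2, fun h => hne (Subtype.ext h), hx, hy⟩
    rw [Stabs, interior_closedBall c hr.ne'] at hws
    exact (hw w hwW hws).elim

theorem mainTheorem6 (n : ℕ) (hn : 2 ≤ n) :
    (n : ℕ∞) ≤ maxDiskStabbingNumber n ∧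
    maxDiskStabbingNumber n ≤ ((2 * n - 2 : ℕ) : ℕ∞) ∧
    maxDiskStabbingNumber n = maxEdgelessWitnessNumber n := by
  refine ⟨?_, ?_, ?_⟩
  · obtain ⟨P, hc, hP, h⟩ := exists_le_diskStabbingNumber hn
    exact h.trans (le_iSup_of_le P (le_iSup_of_le hc (le_iSup_of_le hP le_rfl)))
  · refine iSup_le fun P => iSup_le fun hc => iSup_le fun hP => ?_
    obtain ⟨W, hg, hW, hcard⟩ := exists_stabbing_set P
      (Finset.card_pos.1 (by omega)) hP
    refine iInf_le_of_le W (iInf_le_of_le hg (iInf_le_of_le hW ?_))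
    rw [hc] at hcard
    exact_mod_cast hcard
  · simp only [maxDiskStabbingNumber, maxEdgelessWitnessNumber, diskStabbingNumber,
      edgelessWitnessNumber, witnessDelaunayGraph_eq_bot_iff]
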